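/- Let $\mathcal{E}$ be an elementary topos (finite limits, cartesian closed, with a subobject classifier) with chosen terminal object $1$ and binary products. Let $(\Sigma,E)$ be a variety: a set $\Sigma$ of operation symbols of finite arity and a set $E$ of equations between $\Sigma$-terms in finitely many variables; a $(\Sigma,E)$-algebra in $\mathcal{E}$ is an object $A$ with a morphism $\sigma_A : A^n \to A$ for each $n$-ary $\sigma\in\Sigma$, satisfying the equations in $E$. Let $(Q,\otimes,k,\le)$ be an internal partially ordered commutative monoid in $\mathcal{E}$ (a commutative monoid object with an internal partial order for which $\otimes$ is monotone). An algebraic $Q$-span $A\to B$ between $(\Sigma,E)$-algebras is a quadruple $(X,f,g,\chi)$ of an object $X$ and morphisms $f:X\to A$, $g:X\to B$, $\chi:X\to Q$ of $\mathcal{E}$ such that for every $n$-ary $\sigma\in\Sigma$ the following holds in the internal language of $\mathcal{E}$: $$\forall x_1,\dots,x_n\in X\ \exists x\in X:\quad f(x)=\sigma(f(x_1),\dots,f(x_n)),\quad g(x)=\sigma(g(x_1),\dots,g(x_n)),\quad \chi(x_1)\otimes\dots\otimes\chi(x_n)\le\chi(x).$$ Two such spans $(X,f,g,\chi)$ and $(X',f',g',\chi')$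 are isomorphic if there is an isomorphism $i:X\to X'$ with $f=f'\circ i$, $g=g'\circ i$, $\chi=\chi'\circ i$. Let $\mathrm{Span}_{(\Sigma,E)}(Q)$ be the category whose objects are the $(\Sigma,E)$-algebras in $\mathcal{E}$ and whose morphisms are the isomorphism classes of algebraic $Q$-spans. The composite of $(X,f,g,\chi):A\to B$ and $(Y,h,l,\xi):B\to C$ is the pullback span with apex $X\times_B Y$ and characteristic morphism $(x,y)\mapsto\chi(x)\otimes\xi(y)$; the identity on $A$ is $(A,1_A,1_A,\chi_k)$, where $\chi_k$ is the constant morphism $A\to 1\xrightarrow{k}Q$. For a homomorphism $f:A\to B$ its graph is $f_\circ=(A,1_A,f,\chi_k)$, and the converse of $R=(X,f,g,\chi)$ is $R^\circ=(X,g,f,\chi)$. The symmetric monoidal structure on $\mathrm{Span}_{(\Sigma,E)}(Q)$ is inherited from finite products: the unit is the terminal algebra, the tensor of algebras is their product, the tensor of $(X,f,g,\chi)$ and $(X',f',g',\chi')$ is $(X\times X',f\times f',g\times g',(x,x')\mapsto\chi(x)\otimes\chi'(x'))$, and the coherence isomorphisms are the graphs of those for products of algebras. A hypergraph category is a symmetric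 monoidal category with, on every object $A$, a commutative monoid $(\eta_A,\mu_A)$ and a cocommutative comonoid $(\epsilon_A,\delta_A)$ satisfying the Frobenius axiom $(\mu\otimes 1)(1\otimes\delta)=\delta\mu=(1\otimes\mu)(\delta\otimes 1)$ and the special axiom $\mu\delta=1$, coherently with the monoidal structure: the structure on $A\otimes B$ is obtained from those on $A$ and $B$ via the symmetry, and the structure on the monoidal unit is the canonical one. Then $\mathrm{Span}_{(\Sigma,E)}(Q)$ is a hypergraph category, with comonoid structure on each algebra $A$ given by the graphs of the canonical homomorphisms $!:A\to 1$ and $\langle 1_A,1_A\rangle:A\to A\times A$, $$\epsilon_A=(!)_\circ,\qquad \delta_A=\langle 1_A,1_A\rangle_\circ,$$ and monoid structure given by their converses, $$\eta_A=((!)_\circ)^\circ,\qquad \mu_A=(\langle 1_A,1_A\rangle_\circ)^\circ .$$ -/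

import Mathlib

open CategoryTheory MonoidalCategory CartesianMonoidalCategory Limits
open scoped MonObj

universe w v u

-- Otherwise `⟶` elaborates through reflexive quivers, which hinders rewriting.
attribute [-instance] CategoryTheory.catToReflQuiver

noncomputable section

namespace AlgQSpan

/-! ### Hypergraph categories -/

/-- A hypergraph structure on a symmetric monoidal category: every object carries a commutative
monoid and a cocommutative comonoid satisfying the Frobenius and special axioms, and the choice is
coherent with the monoidal structure. -/
structure HypergraphStructure (C : Type u) [Category.{v} C] [MonoidalCategory C]
    [SymmetricCategory C] where
  mon (A : C) : MonObj A
  mon_comm (A : C) : letI := mon A; IsCommMonObj A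
  comon (A : C) : ComonObj A
  comon_comm (A : C) : letI := comon A; IsCommComonObj A
  /-- The Frobenius axiom, first half. -/
  frobenius_left (A : C) :
    A ◁ (comon A).comul ≫ (α_ A A A).inv ≫ (mon A).mul ▷ A = (mon A).mul ≫ (comon A).comul
  /-- The Frobenius axiom, second half. -/
  frobenius_right (A : C) :
    (comon A).comul ▷ A ≫ (α_ A A A).hom ≫ A ◁ (mon A).mul = (mon A).mul ≫ (comon A).comul
  /-- The special axiom. -/
  special (A : C) : (comon A).comul ≫ (mon A).mul = 𝟙 A
  /-- Coherence of the comonoids with the tensor product. -/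
  comul_tensor (A B : C) :
    (comon (A ⊗ B)).comul = ((comon A).comul ⊗ₘ (comon B).comul) ≫ tensorμ A A B B
  counit_tensor (A B : C) :
    (comon (A ⊗ B)).counit = ((comon A).counit ⊗ₘ (comon B).counit) ≫ (λ_ (𝟙_ C)).hom
  /-- Coherence of the monoids with the tensor product. -/
  mul_tensor (A B : C) :
    (mon (A ⊗ B)).mul = tensorμ A B A B ≫ ((mon A).mul ⊗ₘ (mon B).mul)
  one_tensor (A B : C) :
    (mon (A ⊗ B)).one = (λ_ (𝟙_ C)).inv ≫ ((mon A).one ⊗ₘ (mon B).one)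
  /-- Coherence with the unit object. -/
  comul_unit : (comon (𝟙_ C)).comul = (λ_ (𝟙_ C)).inv
  counit_unit : (comon (𝟙_ C)).counit = 𝟙 (𝟙_ C)
  mul_unit : (mon (𝟙_ C)).mul = (λ_ (𝟙_ C)).hom
  one_unit : (mon (𝟙_ C)).one = 𝟙 (𝟙_ C)

/-! ### Varieties and their algebras -/

/-- A presentation of a variety: a set of operation symbols of finite arity (a first-order language
without relation symbols), and a set of equations, each a pair of terms over a finite list of
variables. -/
structure Variety where
  lang : FirstOrder.Language.{w, 0}
  isAlgebraic : lang.IsAlgebraic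
  eqs : Set (Σ n : ℕ, lang.Term (Fin n) × lang.Term (Fin n))

section Algebras

variable {E : Type u} [Category.{v} E] [HasFiniteProducts E]

/-- The power `Aⁿ`. -/
abbrev pow (A : E) (n : ℕ) : E := ∏ᶜ fun _ : Fin n => A

lemma comp_piLift {T T' X : E} (e : T' ⟶ T) {n : ℕ} (a : Fin n → (T ⟶ X)) :
    e ≫ Pi.lift a = Pi.lift (fun i => e ≫ a i) := by ext; simp

/-- The interpretation `Aᵐ ⟶ A` of a term in `m` variables. -/
def interp {L : FirstOrder.Language.{w, 0}} {A : E}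
    (op : ∀ {n : ℕ}, L.Functions n → (pow A n ⟶ A)) {m : ℕ} :
    L.Term (Fin m) → (pow A m ⟶ A)
  | .var i => Pi.π _ i
  | .func σ ts => Pi.lift (fun i => interp op (ts i)) ≫ op σ

variable (V : Variety.{w}) (E)

/-- An algebra of the variety `V` in `E`. -/
structure Alg where
  carrier : E
  op : ∀ {n : ℕ}, V.lang.Functions n → (pow carrier n ⟶ carrier)
  sat : ∀ e ∈ V.eqs, interp op e.2.1 = interp op e.2.2

variable {V E}

namespace Alg

/-- A morphism of carriers is a homomorphism if it commutes with the operations. -/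
def IsHom (A B : Alg E V) (f : A.carrier ⟶ B.carrier) : Prop :=
  ∀ ⦃n : ℕ⦄ (σ : V.lang.Functions n), A.op σ ≫ f = Limits.Pi.map (fun _ => f) ≫ B.op σ

lemma IsHom.id (A : Alg E V) : IsHom A A (𝟙 _) := fun _ _ => by simp

lemma IsHom.comp {A B C : Alg E V} {f : A.carrier ⟶ B.carrier} {g : B.carrier ⟶ C.carrier}
    (hf : IsHom A B f) (hg : IsHom B C g) : IsHom A C (f ≫ g) := fun _ σ => by
  rw [← Category.assoc, hf, Category.assoc, hg, ← Category.assoc]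
  congr 1
  ext
  simp

/-- Homomorphisms of algebras. -/
@[ext]
structure Hom (A B : Alg E V) where
  hom : A.carrier ⟶ B.carrier
  isHom : IsHom A B hom

instance : Category (Alg E V) where
  Hom := Hom
  id A := ⟨𝟙 _, .id A⟩
  comp f g := ⟨f.hom ≫ g.hom, f.isHom.comp g.isHom⟩

@[ext]
lemma hom_ext {A B : Alg E V} {f g : A ⟶ B} (h : f.hom = g.hom) : f = g := Hom.ext h

@[simp] lemma id_hom (A : Alg E V) : (𝟙 A : A ⟶ A).hom = 𝟙 A.carrier := rfl

@[simp] lemma comp_hom {A B C : Alg E V} (f : A ⟶ B) (g : B ⟶ C) :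
    (f ≫ g).hom = f.hom ≫ g.hom := rfl

lemma interp_hom {L : FirstOrder.Language.{w, 0}} {A B : E}
    (opA : ∀ {n : ℕ}, L.Functions n → (pow A n ⟶ A))
    (opB : ∀ {n : ℕ}, L.Functions n → (pow B n ⟶ B)) (f : A ⟶ B)
    (hf : ∀ {n : ℕ} (σ : L.Functions n), opA σ ≫ f = Limits.Pi.map (fun _ => f) ≫ opB σ) {m : ℕ}
    (t : L.Term (Fin m)) :
    interp opA t ≫ f = Limits.Pi.map (fun _ => f) ≫ interp opB t := by
  induction t with
  | var i => simp [interp]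
  | func σ ts ih =>
    simp only [interp, Category.assoc, hf]
    simp only [← Category.assoc]
    congr 1
    ext i
    simp [ih]

/-- An isomorphism of algebras from an isomorphism of carriers. -/
def mkIso {A B : Alg E V} (e : A.carrier ≅ B.carrier) (h : IsHom A B e.hom)
    (h' : IsHom B A e.inv) : A ≅ B where
  hom := ⟨e.hom, h⟩
  inv := ⟨e.inv, h'⟩
  hom_inv_id := by ext; exact e.hom_inv_id
  inv_hom_id := by ext; exact e.inv_hom_id

end Alg

end Algebras

/-! ### Finite products of algebras -/

namespace Alg

variable {E : Type u} [Category.{v} E] [CartesianMonoidalCategory E] {V : Variety.{w}}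

/-- The terminal algebra. -/
def unit : Alg E V where
  carrier := 𝟙_ E
  op _ := toUnit _
  sat _ _ := toUnit_unique _ _

/-- The product of two algebras; its operations are computed componentwise. -/
def prod (A B : Alg E V) : Alg E V where
  carrier := A.carrier ⊗ B.carrier
  op σ := lift (Limits.Pi.map (fun _ => fst _ _) ≫ A.op σ)
    (Limits.Pi.map (fun _ => snd _ _) ≫ B.op σ)
  sat e he := by
    apply CartesianMonoidalCategory.hom_ext
    · rw [interp_hom _ A.op (fst _ _) (fun _ => lift_fst _ _), A.sat e he,
        ← interp_hom _ A.op (fst _ _) (fun _ => lift_fst _ _)]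
    · rw [interp_hom _ B.op (snd _ _) (fun _ => lift_snd _ _), B.sat e he,
        ← interp_hom _ B.op (snd _ _) (fun _ => lift_snd _ _)]

lemma lift_prod_op {X Y : Alg E V} {n : ℕ} (σ : V.lang.Functions n) {T : E}
    (a : Fin n → (T ⟶ X.carrier ⊗ Y.carrier)) :
    Pi.lift a ≫ (prod X Y).op σ = lift (Pi.lift (fun i => a i ≫ fst _ _) ≫ X.op σ)
      (Pi.lift (fun i => a i ≫ snd _ _) ≫ Y.op σ) := by
  refine (comp_lift _ _ _).trans ?_
  simp only [← Category.assoc]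
  congr 2 <;> ext <;> simp

lemma isHom_toUnit (A : Alg E V) : IsHom A unit (toUnit _) := fun _ _ => toUnit_unique _ _

lemma isHom_fst (A B : Alg E V) : IsHom (prod A B) A (fst A.carrier B.carrier) :=
  fun _ _ => lift_fst _ _

lemma isHom_snd (A B : Alg E V) : IsHom (prod A B) B (snd A.carrier B.carrier) :=
  fun _ _ => lift_snd _ _

lemma isHom_lift {A B C : Alg E V} {f : A.carrier ⟶ B.carrier} {g : A.carrier ⟶ C.carrier}
    (hf : IsHom A B f) (hg : IsHom A C g) : IsHom A (prod B C) (lift f g) := fun n σ => by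
  have h₁ : Limits.Pi.map (fun _ : Fin n => lift f g) ≫ Limits.Pi.map (fun _ => fst _ _) =
      Limits.Pi.map (fun _ => f) := by ext; simp
  have h₂ : Limits.Pi.map (fun _ : Fin n => lift f g) ≫ Limits.Pi.map (fun _ => snd _ _) =
      Limits.Pi.map (fun _ => g) := by ext; simp
  apply CartesianMonoidalCategory.hom_ext
  · simp only [prod, Category.assoc, lift_fst]
    rw [hf, ← Category.assoc, h₁]
  · simp only [prod, Category.assoc, lift_snd]
    rw [hg, ← Category.assoc, h₂]

lemma isHom_tensor {A B C D : Alg E V} {f : A.carrier ⟶ B.carrier} {g : C.carrier ⟶ D.carrier}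
    (hf : IsHom A B f) (hg : IsHom C D g) : IsHom (prod A C) (prod B D) (f ⊗ₘ g) := by
  rw [← lift_fst_comp_snd_comp]
  exact isHom_lift ((isHom_fst _ _).comp hf) ((isHom_snd _ _).comp hg)

instance : MonoidalCategoryStruct (Alg E V) where
  tensorObj := prod
  tensorUnit := unit
  tensorHom f g := ⟨f.hom ⊗ₘ g.hom, isHom_tensor f.isHom g.isHom⟩
  whiskerLeft A _ _ g := ⟨A.carrier ◁ g.hom, by
    rw [← id_tensorHom]; exact isHom_tensor (.id A) g.isHom⟩
  whiskerRight f B := ⟨f.hom ▷ B.carrier, by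
    rw [← tensorHom_id]; exact isHom_tensor f.isHom (.id B)⟩
  associator A B C := mkIso (α_ A.carrier B.carrier C.carrier)
    (by
      have h : (α_ A.carrier B.carrier C.carrier).hom =
        lift (fst _ _ ≫ fst _ _) (lift (fst _ _ ≫ snd _ _) (snd _ _)) := by ext <;> simp
      rw [h]
      exact isHom_lift ((isHom_fst (prod A B) C).comp (isHom_fst A B))
        (isHom_lift ((isHom_fst (prod A B) C).comp (isHom_snd A B)) (isHom_snd (prod A B) C)))
    (by
      have h : (α_ A.carrier B.carrier C.carrier).inv =
        lift (lift (fst _ _) (snd _ _ ≫ fst _ _)) (snd _ _ ≫ snd _ _) := by ext <;> simp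
      rw [h]
      exact isHom_lift (isHom_lift (isHom_fst A (prod B C))
        ((isHom_snd A (prod B C)).comp (isHom_fst B C)))
        ((isHom_snd A (prod B C)).comp (isHom_snd B C)))
  leftUnitor A := mkIso (λ_ A.carrier)
    (by rw [leftUnitor_hom]; exact isHom_snd unit A)
    (by
      have h : (λ_ A.carrier).inv = lift (toUnit _) (𝟙 _) := by ext; simp
      rw [h]
      exact isHom_lift (isHom_toUnit A) (.id A))
  rightUnitor A := mkIso (ρ_ A.carrier)
    (by rw [rightUnitor_hom]; exact isHom_fst A unit)
    (by
      have h : (ρ_ A.carrier).inv = lift (𝟙 _) (toUnit _) := by ext; simp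
      rw [h]
      exact isHom_lift (.id A) (isHom_toUnit A))

@[simp] lemma tensorObj_carrier (A B : Alg E V) : (A ⊗ B).carrier = A.carrier ⊗ B.carrier := rfl
@[simp] lemma tensorUnit_carrier : (𝟙_ (Alg E V)).carrier = 𝟙_ E := rfl
@[simp] lemma tensorHom_hom {A B C D : Alg E V} (f : A ⟶ B) (g : C ⟶ D) :
    (f ⊗ₘ g).hom = f.hom ⊗ₘ g.hom := rfl
@[simp] lemma whiskerLeft_hom (A : Alg E V) {C D : Alg E V} (g : C ⟶ D) :
    (A ◁ g).hom = A.carrier ◁ g.hom := rfl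
@[simp] lemma whiskerRight_hom {A B : Alg E V} (f : A ⟶ B) (C : Alg E V) :
    (f ▷ C).hom = f.hom ▷ C.carrier := rfl
@[simp] lemma associator_hom_hom (A B C : Alg E V) :
    (α_ A B C).hom.hom = (α_ A.carrier B.carrier C.carrier).hom := rfl
@[simp] lemma associator_inv_hom (A B C : Alg E V) :
    (α_ A B C).inv.hom = (α_ A.carrier B.carrier C.carrier).inv := rfl
@[simp] lemma leftUnitor_hom_hom (A : Alg E V) : (λ_ A).hom.hom = (λ_ A.carrier).hom := rfl
@[simp] lemma leftUnitor_inv_hom (A : Alg E V) : (λ_ A).inv.hom = (λ_ A.carrier).inv := rfl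
@[simp] lemma rightUnitor_hom_hom (A : Alg E V) : (ρ_ A).hom.hom = (ρ_ A.carrier).hom := rfl
@[simp] lemma rightUnitor_inv_hom (A : Alg E V) : (ρ_ A).inv.hom = (ρ_ A.carrier).inv := rfl

/-- The category of algebras has finite products, computed as in `E`. -/
instance : CartesianMonoidalCategory (Alg E V) where
  tensorHom_def _ _ := by ext1; simp [MonoidalCategory.tensorHom_def]
  id_tensorHom_id _ _ := by ext1; simp
  tensorHom_comp_tensorHom _ _ _ _ := by ext1; simp
  whiskerLeft_id _ _ := by ext1; simp
  id_whiskerRight _ _ := by ext1; simp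
  associator_naturality _ _ _ := by ext1; simp
  leftUnitor_naturality _ := by ext1; simp
  rightUnitor_naturality _ := by ext1; simp
  pentagon _ _ _ _ := by ext1; simp
  triangle _ _ := by ext1; simp
  isTerminalTensorUnit := IsTerminal.ofUniqueHom
    (fun A => ⟨toUnit _, isHom_toUnit A⟩) (fun A f => by ext1; exact toUnit_unique _ _)
  fst A B := ⟨fst _ _, isHom_fst A B⟩
  snd A B := ⟨snd _ _, isHom_snd A B⟩
  tensorProductIsBinaryProduct A B := BinaryFan.IsLimit.mk _
    (fun f g => ⟨lift f.hom g.hom, isHom_lift f.isHom g.isHom⟩)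
    (fun f g => by ext1; simp)
    (fun f g => by ext1; simp)
    (fun f g m hf hg => by
      ext1
      apply CartesianMonoidalCategory.hom_ext
      · simpa using congrArg Hom.hom hf
      · simpa using congrArg Hom.hom hg)
  fst_def A B := by
    ext1
    simp only [fst_def, comp_hom, whiskerLeft_hom, rightUnitor_hom_hom]
    congr 2
  snd_def A B := by
    ext1
    simp only [snd_def, comp_hom, whiskerRight_hom, leftUnitor_hom_hom]
    congr 2

instance : BraidedCategory (Alg E V) := .ofCartesianMonoidalCategory

@[simp] lemma fst_hom (A B : Alg E V) : (fst A B).hom = fst A.carrier B.carrier := rfl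
@[simp] lemma snd_hom (A B : Alg E V) : (snd A B).hom = snd A.carrier B.carrier := rfl
@[simp] lemma lift_hom {A B C : Alg E V} (f : A ⟶ B) (g : A ⟶ C) :
    (lift f g).hom = lift f.hom g.hom := rfl
@[simp] lemma toUnit_hom (A : Alg E V) : (toUnit A).hom = toUnit A.carrier := rfl

end Alg

/-! ### Internal partially ordered commutative monoids -/

/-- An internal partially ordered commutative monoid of `E`. The order is a subobject of `Q × Q`;
its axioms are stated for generalized elements `T ⟶ Q`, where `a ≤ b` means that
`⟨a, b⟩ : T ⟶ Q × Q` factors through that subobject, and where `a * b` is `⟨a, b⟩` followed by the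
multiplication of `Q`. -/
structure PoCommMon (E : Type u) [Category.{v} E] [CartesianMonoidalCategory E]
    [BraidedCategory E] where
  carrier : E
  [mon : MonObj carrier]
  [comm : IsCommMonObj carrier]
  le : Subobject (carrier ⊗ carrier)
  le_refl : ∀ {T : E} (a : T ⟶ carrier), le.Factors (lift a a)
  le_trans : ∀ {T : E} (a b c : T ⟶ carrier),
    le.Factors (lift a b) → le.Factors (lift b c) → le.Factors (lift a c)
  le_antisymm : ∀ {T : E} (a b : T ⟶ carrier),
    le.Factors (lift a b) → le.Factors (lift b a) → a = b
  mul_le_mul : ∀ {T : E} (a b c d : T ⟶ carrier),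
    le.Factors (lift a b) → le.Factors (lift c d) → le.Factors (lift (a * c) (b * d))

attribute [instance] PoCommMon.mon PoCommMon.comm

/-! ### `Q`-spans -/

section Spans

variable {E : Type u} [Category.{v} E]

/-- A `Q`-span from `A` to `B`: a span together with a characteristic morphism to `Q`. -/
structure QSpan (Q A B : E) where
  apex : E
  left : apex ⟶ A
  right : apex ⟶ B
  chi : apex ⟶ Q

namespace QSpan

variable {Q : E} {A B C D : E}

/-- Isomorphism of `Q`-spans. -/
def Equiv (S T : QSpan Q A B) : Prop :=
  ∃ i : S.apex ≅ T.apex,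
    S.left = i.hom ≫ T.left ∧ S.right = i.hom ≫ T.right ∧ S.chi = i.hom ≫ T.chi

lemma Equiv.refl (S : QSpan Q A B) : S.Equiv S := ⟨Iso.refl _, by simp, by simp, by simp⟩

lemma Equiv.symm {S T : QSpan Q A B} : S.Equiv T → T.Equiv S := by
  rintro ⟨i, h₁, h₂, h₃⟩
  exact ⟨i.symm, by simp [h₁], by simp [h₂], by simp [h₃]⟩

lemma Equiv.trans {S T U : QSpan Q A B} : S.Equiv T → T.Equiv U → S.Equiv U := by
  rintro ⟨i, h₁, h₂, h₃⟩ ⟨j, k₁, k₂, k₃⟩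
  exact ⟨i ≪≫ j, by simp [h₁, k₁], by simp [h₂, k₂], by simp [h₃, k₃]⟩

/-- The converse of a `Q`-span. -/
@[simps]
def converse (S : QSpan Q A B) : QSpan Q B A := ⟨S.apex, S.right, S.left, S.chi⟩

lemma Equiv.converse {S T : QSpan Q A B} : S.Equiv T → S.converse.Equiv T.converse := by
  rintro ⟨i, h₁, h₂, h₃⟩
  exact ⟨i, h₂, h₁, h₃⟩

lemma equiv_mk {X Y : E} {f : X ⟶ A} {g : X ⟶ B} {c : X ⟶ Q} {f' : Y ⟶ A} {g' : Y ⟶ B} {c' : Y ⟶ Q}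
    (i : X ≅ Y) (h₁ : f = i.hom ≫ f') (h₂ : g = i.hom ≫ g') (h₃ : c = i.hom ≫ c') :
    Equiv (⟨X, f, g, c⟩ : QSpan Q A B) ⟨Y, f', g', c'⟩ := ⟨i, h₁, h₂, h₃⟩

lemma equiv_mk_eq {X : E} {f f' : X ⟶ A} {g g' : X ⟶ B} {c c' : X ⟶ Q}
    (h₁ : f = f') (h₂ : g = g') (h₃ : c = c') :
    Equiv (⟨X, f, g, c⟩ : QSpan Q A B) ⟨X, f', g', c'⟩ :=
  equiv_mk (Iso.refl X) (by simp [h₁]) (by simp [h₂]) (by simp [h₃])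

variable [CartesianMonoidalCategory E] [MonObj Q]

/-- The graph of a morphism; here `1` is the constant morphism at the unit of `Q`. -/
@[simps]
def graph (f : A ⟶ B) : QSpan Q A B := ⟨A, 𝟙 A, f, 1⟩

/-- The tensor product of `Q`-spans: the product of the underlying spans, with characteristic
morphism `(x, y) ↦ χ(x) * ξ(y)`. -/
@[simps]
def tensor (S : QSpan Q A B) (T : QSpan Q C D) : QSpan Q (A ⊗ C) (B ⊗ D) :=
  ⟨S.apex ⊗ T.apex, S.left ⊗ₘ T.left, S.right ⊗ₘ T.right, (fst _ _ ≫ S.chi) * (snd _ _ ≫ T.chi)⟩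

/-- Composition of `Q`-spans by pullback, with characteristic morphism `(x, y) ↦ χ(x) * ξ(y)`. -/
def comp [HasPullbacks E] (S : QSpan Q A B) (T : QSpan Q B C) : QSpan Q A C where
  apex := pullback S.right T.left
  left := pullback.fst S.right T.left ≫ S.left
  right := pullback.snd S.right T.left ≫ T.right
  chi := (pullback.fst S.right T.left ≫ S.chi) * (pullback.snd S.right T.left ≫ T.chi)

lemma tensor_mk {X Y : E} (f : X ⟶ A) (g : X ⟶ B) (c : X ⟶ Q) (f' : Y ⟶ C) (g' : Y ⟶ D)
    (c' : Y ⟶ Q) : tensor ⟨X, f, g, c⟩ ⟨Y, f', g', c'⟩ =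
      ⟨X ⊗ Y, f ⊗ₘ f', g ⊗ₘ g', (fst X Y ≫ c) * (snd X Y ≫ c')⟩ := rfl

lemma Equiv.tensor {S S' : QSpan Q A B} {T T' : QSpan Q C D} (hS : S.Equiv S') (hT : T.Equiv T') :
    (S.tensor T).Equiv (S'.tensor T') := by
  obtain ⟨i, h₁, h₂, h₃⟩ := hS
  obtain ⟨j, k₁, k₂, k₃⟩ := hT
  refine equiv_mk (i ⊗ᵢ j) ?_ ?_ ?_
  · simp [h₁, k₁]
  · simp [h₂, k₂]
  · simp [h₃, k₃, MonObj.comp_mul]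

lemma isPullback_tensor {X Y Z P X' Y' Z' P' : E} {p : P ⟶ X} {q : P ⟶ Y} {f : X ⟶ Z} {g : Y ⟶ Z}
    {p' : P' ⟶ X'} {q' : P' ⟶ Y'} {f' : X' ⟶ Z'} {g' : Y' ⟶ Z'} (h : IsPullback p q f g)
    (h' : IsPullback p' q' f' g') :
    IsPullback (p ⊗ₘ p') (q ⊗ₘ q') (f ⊗ₘ f') (g ⊗ₘ g') := by
  refine ⟨⟨by simp [h.w, h'.w]⟩, ⟨PullbackCone.IsLimit.mk _
    (fun s => lift (h.lift (s.fst ≫ fst _ _) (s.snd ≫ fst _ _) ?_)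
      (h'.lift (s.fst ≫ snd _ _) (s.snd ≫ snd _ _) ?_)) ?_ ?_ ?_⟩⟩
  · simpa using s.condition =≫ fst _ _
  · simpa using s.condition =≫ snd _ _
  · intro s
    ext <;> simp
  · intro s
    ext <;> simp
  · intro s m h₁ h₂
    apply CartesianMonoidalCategory.hom_ext
    · apply h.hom_ext
      · simp [← h₁]
      · simp [← h₂]
    · apply h'.hom_ext
      · simp [← h₁]
      · simp [← h₂]

lemma tensor_graph {A' B' : E} (f : A ⟶ B) (g : A' ⟶ B') :
    ((graph (Q := Q) f).tensor (graph g)).Equiv (graph (f ⊗ₘ g)) := by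
  refine equiv_mk_eq (id_tensorHom_id A A') rfl ?_
  change (fst A A' ≫ (1 : A ⟶ Q)) * (snd A A' ≫ (1 : A' ⟶ Q)) = 1
  simp [MonObj.comp_one]

variable [HasPullbacks E]

/-- Composites may be computed with an arbitrary pullback. -/
lemma comp_equiv {X Y P : E} {f : X ⟶ A} {g : X ⟶ B} {c : X ⟶ Q} {f' : Y ⟶ B} {g' : Y ⟶ C}
    {c' : Y ⟶ Q} {p : P ⟶ X} {q : P ⟶ Y} (h : IsPullback p q g f') :
    Equiv (comp (⟨X, f, g, c⟩ : QSpan Q A B) ⟨Y, f', g', c'⟩)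
      ⟨P, p ≫ f, q ≫ g', (p ≫ c) * (q ≫ c')⟩ :=
  equiv_mk ((IsPullback.of_hasPullback g f').isoIsPullback _ _ h) (by simp) (by simp)
    (by simp [MonObj.comp_mul])

lemma Equiv.comp {S S' : QSpan Q A B} {T T' : QSpan Q B C} (hS : S.Equiv S') (hT : T.Equiv T') :
    (S.comp T).Equiv (S'.comp T') := by
  obtain ⟨X, f, g, c⟩ := S
  obtain ⟨X', f', g', c'⟩ := S'
  obtain ⟨Y, h, k, d⟩ := T
  obtain ⟨Y', h', k', d'⟩ := T'
  obtain ⟨i, h₁, h₂, h₃⟩ := hS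
  obtain ⟨j, k₁, k₂, k₃⟩ := hT
  dsimp only at *
  have hp : IsPullback (pullback.fst g h ≫ i.hom) (pullback.snd g h ≫ j.hom) g' h' :=
    (IsPullback.of_hasPullback g h).of_iso (Iso.refl _) i j (Iso.refl _)
      (by simp) (by simp) (by simp [h₂]) (by simp [k₁])
  refine (comp_equiv (.of_hasPullback g h)).trans
    (Equiv.trans (equiv_mk_eq ?_ ?_ ?_) (comp_equiv hp).symm)
  · simp [h₁]
  · simp [k₂]
  · simp [h₃, k₃]

lemma comp_graph {X : E} (f : X ⟶ A) (g : X ⟶ B) (c : X ⟶ Q) (k : B ⟶ C) :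
    (comp ⟨X, f, g, c⟩ (graph k)).Equiv ⟨X, f, g ≫ k, c⟩ := by
  refine (comp_equiv (IsPullback.id_horiz g)).trans (equiv_mk_eq ?_ ?_ ?_) <;>
    simp [MonObj.comp_one]

lemma graph_comp_of_iso (h : A ≅ B) {X : E} (f : X ⟶ B) (g : X ⟶ C) (c : X ⟶ Q) :
    ((graph h.hom).comp ⟨X, f, g, c⟩).Equiv ⟨X, f ≫ h.inv, g, c⟩ := by
  have hp : IsPullback (f ≫ h.inv) (𝟙 X) h.hom f := .of_vert_isIso ⟨by simp⟩
  refine (comp_equiv hp).trans (equiv_mk_eq ?_ ?_ ?_) <;> simp [MonObj.comp_one]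

lemma id_comp (S : QSpan Q A B) : ((graph (𝟙 A)).comp S).Equiv S := by
  obtain ⟨X, f, g, c⟩ := S
  refine (graph_comp_of_iso (Iso.refl A) f g c).trans (equiv_mk_eq ?_ ?_ ?_) <;> simp

lemma comp_id (S : QSpan Q A B) : (S.comp (graph (𝟙 B))).Equiv S := by
  obtain ⟨X, f, g, c⟩ := S
  refine (comp_graph f g c (𝟙 B)).trans (equiv_mk_eq ?_ ?_ ?_) <;> simp

lemma graph_comp_graph (f : A ⟶ B) (g : B ⟶ C) :
    ((graph (Q := Q) f).comp (graph g)).Equiv (graph (f ≫ g)) :=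
  comp_graph (𝟙 A) f 1 g

lemma assoc (S : QSpan Q A B) (T : QSpan Q B C) (U : QSpan Q C D) :
    ((S.comp T).comp U).Equiv (S.comp (T.comp U)) := by
  obtain ⟨X, f, g, c⟩ := S
  obtain ⟨Y, f', g', c'⟩ := T
  obtain ⟨Z, f'', g'', c''⟩ := U
  have h₁ := IsPullback.of_hasPullback g f'
  have h₂ := IsPullback.of_hasPullback g' f''
  have h₃ := IsPullback.of_hasPullback (pullback.snd g f') (pullback.fst g' f'')
  refine ((comp_equiv h₁).comp (.refl _)).trans ((comp_equiv (h₃.paste_vert h₂)).trans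
    (Equiv.trans (equiv_mk_eq ?_ ?_ ?_) (Equiv.symm (((Equiv.refl _).comp
      (comp_equiv h₂)).trans (comp_equiv (h₃.flip.paste_vert h₁.flip).flip)))))
  · simp
  · simp
  · simp [MonObj.comp_mul, mul_assoc, pullback.condition_assoc]

section

variable [BraidedCategory E] [IsCommMonObj Q] {A' B' C' A'' B'' : E}

lemma tensor_comp (S : QSpan Q A B) (T : QSpan Q B C) (S' : QSpan Q A' B') (T' : QSpan Q B' C') :
    ((S.tensor S').comp (T.tensor T')).Equiv ((S.comp T).tensor (S'.comp T')) := by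
  obtain ⟨X, f, g, c⟩ := S
  obtain ⟨Y, h, k, d⟩ := T
  obtain ⟨X', f', g', c'⟩ := S'
  obtain ⟨Y', h', k', d'⟩ := T'
  have h₁ := IsPullback.of_hasPullback g h
  have h₂ := IsPullback.of_hasPullback g' h'
  refine (comp_equiv (isPullback_tensor h₁ h₂)).trans (Equiv.trans (equiv_mk_eq ?_ ?_ ?_)
    ((comp_equiv h₁).tensor (comp_equiv h₂)).symm)
  · simp
  · simp
  · simp [MonObj.comp_mul, mul_mul_mul_comm]

lemma braiding_naturality (S : QSpan Q A B) (S' : QSpan Q A' B') :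
    ((S.tensor S').comp (graph (β_ B B').hom)).Equiv
      ((graph (β_ A A').hom).comp (S'.tensor S)) := by
  obtain ⟨X, f, g, c⟩ := S
  obtain ⟨X', f', g', c'⟩ := S'
  refine (comp_graph _ _ _ _).trans (Equiv.trans (equiv_mk (β_ X X') ?_ ?_ ?_)
    (graph_comp_of_iso (β_ A A') _ _ _).symm)
  · simp
  · simp
  · simp [MonObj.comp_mul, mul_comm]

end

lemma associator_naturality {A' B' A'' B'' : E} (S : QSpan Q A B) (S' : QSpan Q A' B')
    (S'' : QSpan Q A'' B'') :
    (((S.tensor S').tensor S'').comp (graph (α_ B B' B'').hom)).Equiv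
      ((graph (α_ A A' A'').hom).comp (S.tensor (S'.tensor S''))) := by
  obtain ⟨X, f, g, c⟩ := S
  obtain ⟨X', f', g', c'⟩ := S'
  obtain ⟨X'', f'', g'', c''⟩ := S''
  simp only [tensor_mk]
  refine (comp_graph _ _ _ _).trans (Equiv.trans (equiv_mk (α_ X X' X'') ?_ ?_ ?_)
    (graph_comp_of_iso (α_ A A' A'') _ _ _).symm)
  · simp
  · simp
  · simp [MonObj.comp_mul, mul_assoc]

lemma leftUnitor_naturality (S : QSpan Q A B) :
    (((graph (𝟙 (𝟙_ E))).tensor S).comp (graph (λ_ B).hom)).Equiv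
      ((graph (λ_ A).hom).comp S) := by
  obtain ⟨X, f, g, c⟩ := S
  change (comp (tensor ⟨𝟙_ E, 𝟙 _, 𝟙 _, 1⟩ ⟨X, f, g, c⟩) _).Equiv _
  rw [tensor_mk]
  refine (comp_graph _ _ _ _).trans (Equiv.trans (equiv_mk (λ_ X) ?_ ?_ ?_)
    (graph_comp_of_iso (λ_ A) _ _ _).symm)
  · simp
  · simp
  · simp [MonObj.comp_one, leftUnitor_hom]

lemma rightUnitor_naturality (S : QSpan Q A B) :
    ((S.tensor (graph (𝟙 (𝟙_ E)))).comp (graph (ρ_ B).hom)).Equiv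
      ((graph (ρ_ A).hom).comp S) := by
  obtain ⟨X, f, g, c⟩ := S
  change (comp (tensor ⟨X, f, g, c⟩ ⟨𝟙_ E, 𝟙 _, 𝟙 _, 1⟩) _).Equiv _
  rw [tensor_mk]
  refine (comp_graph _ _ _ _).trans (Equiv.trans (equiv_mk (ρ_ X) ?_ ?_ ?_)
    (graph_comp_of_iso (ρ_ A) _ _ _).symm)
  · simp
  · simp
  · simp [MonObj.comp_one, rightUnitor_hom]

end QSpan

end Spans

/-! ### Algebraic `Q`-spans -/

section AlgebraicSpans

variable {E : Type u} [Category.{v} E] [CartesianMonoidalCategory E] [BraidedCategory E]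
  {V : Variety.{w}} {Q : PoCommMon E} {A B C D : Alg E V}

/-- Algebraic `Q`-spans. This is the Kripke-Joyal interpretation in the topos `E` of the formula:
for every operation `σ` and all `x₁, …, xₙ` in the apex there exists `y` in the apex with
`f y = σ (f x₁, …, f xₙ)`, `g y = σ (g x₁, …, g xₙ)` and `χ x₁ * ⋯ * χ xₙ ≤ χ y`.
That is, universally quantified variables range over generalized elements at an arbitrary stage `T`,
and existence at stage `T` is witnessed after passing to a cover of `T`, i.e. along an
epimorphism `e : T' ⟶ T`. -/
def IsAlgebraic (S : QSpan Q.carrier A.carrier B.carrier) : Prop :=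
  ∀ ⦃n : ℕ⦄ (σ : V.lang.Functions n) ⦃T : E⦄ (x : Fin n → (T ⟶ S.apex)),
    ∃ (T' : E) (e : T' ⟶ T) (y : T' ⟶ S.apex), Epi e ∧
      y ≫ S.left = e ≫ Pi.lift (fun i => x i ≫ S.left) ≫ A.op σ ∧
      y ≫ S.right = e ≫ Pi.lift (fun i => x i ≫ S.right) ≫ B.op σ ∧
      Q.le.Factors (lift (e ≫ ∏ i, (x i ≫ S.chi)) (y ≫ S.chi))

namespace IsAlgebraic

lemma comp_prod {T T' : E} (e : T' ⟶ T) {n : ℕ} (a : Fin n → (T ⟶ Q.carrier)) :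
    e ≫ ∏ i, a i = ∏ i, (e ≫ a i) :=
  map_prod (⟨⟨fun a => e ≫ a, MonObj.comp_one e⟩, fun a b => MonObj.comp_mul e a b⟩ :
    (T ⟶ Q.carrier) →* (T' ⟶ Q.carrier)) a Finset.univ

lemma le_comp {T T' : E} (e : T' ⟶ T) {a b : T ⟶ Q.carrier} (h : Q.le.Factors (lift a b)) :
    Q.le.Factors (lift (e ≫ a) (e ≫ b)) := by
  rw [← comp_lift]
  exact Subobject.factors_of_factors_right e h

lemma of_equiv {S T : QSpan Q.carrier A.carrier B.carrier} (h : S.Equiv T)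
    (hS : IsAlgebraic (A := A) (B := B) S) : IsAlgebraic (A := A) (B := B) T := by
  obtain ⟨i, h₁, h₂, h₃⟩ := h.symm
  obtain ⟨X, f, g, c⟩ := S
  obtain ⟨X', f', g', c'⟩ := T
  intro n σ U x
  dsimp only at i h₁ h₂ h₃ x
  obtain ⟨U', e, y, he, k₁, k₂, k₃⟩ := hS σ (fun j => x j ≫ i.hom)
  dsimp only at y k₁ k₂ k₃ ⊢
  subst h₁ h₂ h₃
  exact ⟨U', e, y ≫ i.inv, he, by simpa using k₁, by simpa using k₂, by simpa using k₃⟩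

lemma converse {S : QSpan Q.carrier A.carrier B.carrier}
    (hS : IsAlgebraic (A := A) (B := B) S) : IsAlgebraic (A := B) (B := A) S.converse := by
  intro n σ U x
  obtain ⟨U', e, y, he, k₁, k₂, k₃⟩ := hS σ x
  exact ⟨U', e, y, he, k₂, k₁, k₃⟩

lemma graph (f : A ⟶ B) :
    IsAlgebraic (A := A) (B := B) (QSpan.graph (Q := Q.carrier) f.hom) := by
  intro n σ U x
  change Fin n → (U ⟶ A.carrier) at x
  refine ⟨U, 𝟙 U, Pi.lift x ≫ A.op σ, inferInstance, ?_, ?_, ?_⟩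
  · change (Pi.lift x ≫ A.op σ) ≫ 𝟙 _ = 𝟙 U ≫ Pi.lift (fun i => x i ≫ 𝟙 _) ≫ A.op σ
    simp
  · change (Pi.lift x ≫ A.op σ) ≫ f.hom = 𝟙 U ≫ Pi.lift (fun i => x i ≫ f.hom) ≫ B.op σ
    rw [Category.assoc, f.isHom σ, Category.id_comp, ← Category.assoc]
    congr 1
    ext
    simp
  · change Q.le.Factors (lift (𝟙 U ≫ ∏ i, (x i ≫ (1 : A.carrier ⟶ Q.carrier)))
      ((Pi.lift x ≫ A.op σ) ≫ (1 : A.carrier ⟶ Q.carrier)))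
    simp only [MonObj.comp_one, Finset.prod_const_one]
    exact Q.le_refl _

lemma comp [HasPullbacks E] {S : QSpan Q.carrier A.carrier B.carrier}
    {T : QSpan Q.carrier B.carrier C.carrier} (hS : IsAlgebraic (A := A) (B := B) S)
    (hT : IsAlgebraic (A := B) (B := C) T) : IsAlgebraic (A := A) (B := C) (S.comp T) := by
  intro n σ U x
  change Fin n → (U ⟶ pullback S.right T.left) at x
  obtain ⟨U', e, y, he, k₁, k₂, k₃⟩ := hS σ (fun i => x i ≫ pullback.fst S.right T.left)
  obtain ⟨U'', e', y', he', l₁, l₂, l₃⟩ :=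
    hT σ (fun i => e ≫ x i ≫ pullback.snd S.right T.left)
  have hw : (e' ≫ y) ≫ S.right = y' ≫ T.left := by
    rw [Category.assoc, k₂, l₁]
    congr 1
    rw [← Category.assoc, comp_piLift]
    simp [pullback.condition]
  refine ⟨U'', e' ≫ e, pullback.lift (e' ≫ y) y' hw, epi_comp _ _, ?_, ?_, ?_⟩
  · change pullback.lift (e' ≫ y) y' hw ≫ pullback.fst _ _ ≫ S.left =
      (e' ≫ e) ≫ Pi.lift (fun i => x i ≫ pullback.fst _ _ ≫ S.left) ≫ A.op σ
    rw [pullback.lift_fst_assoc, Category.assoc, k₁]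
    simp only [Category.assoc]
  · change pullback.lift (e' ≫ y) y' hw ≫ pullback.snd _ _ ≫ T.right =
      (e' ≫ e) ≫ Pi.lift (fun i => x i ≫ pullback.snd _ _ ≫ T.right) ≫ C.op σ
    simp only [pullback.lift_snd_assoc, l₂, Category.assoc]
    congr 1
    rw [← Category.assoc e, comp_piLift]
  · change Q.le.Factors (lift ((e' ≫ e) ≫ ∏ i, (x i ≫ (pullback.fst _ _ ≫ S.chi *
      pullback.snd _ _ ≫ T.chi))) (pullback.lift (e' ≫ y) y' hw ≫ (pullback.fst _ _ ≫ S.chi *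
      pullback.snd _ _ ≫ T.chi)))
    have h := Q.mul_le_mul _ _ _ _ (le_comp e' k₃) l₃
    simp only [MonObj.comp_mul, pullback.lift_fst_assoc, pullback.lift_snd_assoc,
      Finset.prod_mul_distrib]
    simpa only [comp_prod, Category.assoc] using h

lemma tensor {S : QSpan Q.carrier A.carrier B.carrier} {T : QSpan Q.carrier C.carrier D.carrier}
    (hS : IsAlgebraic (A := A) (B := B) S) (hT : IsAlgebraic (A := C) (B := D) T) :
    IsAlgebraic (A := A ⊗ C) (B := B ⊗ D) (S.tensor T) := by
  intro n σ U x
  change Fin n → (U ⟶ S.apex ⊗ T.apex) at x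
  obtain ⟨U', e, y, he, k₁, k₂, k₃⟩ := hS σ (fun i => x i ≫ fst _ _)
  obtain ⟨U'', e', y', he', l₁, l₂, l₃⟩ := hT σ (fun i => e ≫ x i ≫ snd _ _)
  have key : ∀ {X Y : Alg E V} (f : S.apex ⟶ X.carrier) (g : T.apex ⟶ Y.carrier),
      y ≫ f = e ≫ Pi.lift (fun i => (x i ≫ fst _ _) ≫ f) ≫ X.op σ →
      y' ≫ g = e' ≫ Pi.lift (fun i => (e ≫ x i ≫ snd _ _) ≫ g) ≫ Y.op σ →
      lift (e' ≫ y) y' ≫ (f ⊗ₘ g) =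
        (e' ≫ e) ≫ Pi.lift (fun i => x i ≫ (f ⊗ₘ g)) ≫ (X ⊗ Y).op σ := by
    intro X Y f g hf hg
    have h := Alg.lift_prod_op (X := X) (Y := Y) σ (fun i => x i ≫ (f ⊗ₘ g))
    refine Eq.trans ?_ ((congrArg (fun t => (e' ≫ e) ≫ t) h).trans (comp_lift _ _ _)).symm
    simp only [Category.assoc, lift_map, tensorHom_fst, tensorHom_snd, hf, hg]
    congr 2
    rw [← Category.assoc e, comp_piLift]
  refine ⟨U'', e' ≫ e, lift (e' ≫ y) y', epi_comp _ _, key _ _ k₁ l₁, key _ _ k₂ l₂, ?_⟩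
  change Q.le.Factors (lift ((e' ≫ e) ≫ ∏ i, (x i ≫ (fst _ _ ≫ S.chi * snd _ _ ≫ T.chi)))
    (lift (e' ≫ y) y' ≫ (fst _ _ ≫ S.chi * snd _ _ ≫ T.chi)))
  have h := Q.mul_le_mul _ _ _ _ (le_comp e' k₃) l₃
  simp only [MonObj.comp_mul, lift_fst_assoc, lift_snd_assoc, Finset.prod_mul_distrib]
  simpa only [comp_prod, Category.assoc] using h

end IsAlgebraic

variable (Q A B) in
/-- Algebraic `Q`-spans between the algebras `A` and `B`. -/
def AlgSpan : Type max u v :=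
  {S : QSpan Q.carrier A.carrier B.carrier // IsAlgebraic (A := A) (B := B) S}

variable (Q A B) in
/-- Isomorphism of algebraic `Q`-spans. -/
instance AlgSpan.setoid : Setoid (AlgSpan Q A B) where
  r S T := S.1.Equiv T.1
  iseqv := ⟨fun S => .refl S.1, .symm, .trans⟩

end AlgebraicSpans

/-! ### The category of algebras and algebraic `Q`-spans -/

section SpanCat

variable {E : Type u} [Category.{v} E] [CartesianMonoidalCategory E] [BraidedCategory E]

/-- The category with objects the `V`-algebras in `E`, and morphisms the isomorphism classes of
algebraic `Q`-spans. -/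
@[ext]
structure SpanCat (V : Variety.{w}) (Q : PoCommMon E) where
  alg : Alg E V

namespace SpanCat

variable {V : Variety.{w}} {Q : PoCommMon E}

/-- Isomorphism classes of algebraic `Q`-spans. -/
def Hom (A B : SpanCat V Q) : Type max u v := Quotient (AlgSpan.setoid Q A.alg B.alg)

/-- The isomorphism class of an algebraic `Q`-span. -/
def Hom.mk {A B : SpanCat V Q} (S : AlgSpan Q A.alg B.alg) : Hom A B := Quotient.mk _ S

/-- The graph of a homomorphism. -/
def graphHom {A B : Alg E V} (f : A ⟶ B) : Hom (⟨A⟩ : SpanCat V Q) ⟨B⟩ :=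
  Hom.mk ⟨QSpan.graph f.hom, .graph f⟩

/-- The converse of an isomorphism class of algebraic `Q`-spans. -/
def converseHom {A B : SpanCat V Q} : Hom A B → Hom B A :=
  Quotient.map (fun S => ⟨S.1.converse, S.2.converse⟩) (fun _ _ h => QSpan.Equiv.converse h)

/-- The tensor product of isomorphism classes of algebraic `Q`-spans. -/
def tensorHom' {A B C D : SpanCat V Q} :
    Hom A B → Hom C D → Hom (⟨A.alg ⊗ C.alg⟩ : SpanCat V Q) ⟨B.alg ⊗ D.alg⟩ :=
  Quotient.map₂ (fun S T => ⟨S.1.tensor T.1, S.2.tensor T.2⟩)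
    (fun _ _ h _ _ h' => QSpan.Equiv.tensor h h')

variable [HasPullbacks E]

/-- Composition of isomorphism classes of algebraic `Q`-spans. -/
def compHom {A B C : SpanCat V Q} : Hom A B → Hom B C → Hom A C :=
  Quotient.map₂ (fun S T => ⟨S.1.comp T.1, S.2.comp T.2⟩)
    (fun _ _ h _ _ h' => QSpan.Equiv.comp h h')

instance : Category.{max u v} (SpanCat V Q) where
  Hom := Hom
  id A := graphHom (𝟙 A.alg)
  comp := compHom
  id_comp := by
    rintro A B ⟨S⟩
    exact Quotient.sound (QSpan.id_comp S.1)
  comp_id := by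
    rintro A B ⟨S⟩
    exact Quotient.sound (QSpan.comp_id S.1)
  assoc := by
    rintro A B C D ⟨S⟩ ⟨T⟩ ⟨U⟩
    exact Quotient.sound (QSpan.assoc S.1 T.1 U.1)

variable (V Q) in
/-- The graph functor: it is the identity on objects and sends `f : A ⟶ B` to the class of
`(A, 1, f, χ_k)`. -/
def graph : Alg E V ⥤ SpanCat V Q where
  obj A := ⟨A⟩
  map f := graphHom f
  map_id _ := rfl
  map_comp f g := (Quotient.sound (QSpan.graph_comp_graph f.hom g.hom)).symm

/-- The converse of a morphism: it sends the class of `(X, f, g, χ)` to that of `(X, g, f, χ)`. -/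
def converse {A B : SpanCat V Q} (R : A ⟶ B) : B ⟶ A := converseHom R

instance : MonoidalCategoryStruct (SpanCat V Q) where
  tensorObj A B := ⟨A.alg ⊗ B.alg⟩
  tensorUnit := ⟨𝟙_ (Alg E V)⟩
  tensorHom f g := tensorHom' f g
  whiskerLeft A _ _ g := tensorHom' (𝟙 A) g
  whiskerRight f B := tensorHom' f (𝟙 B)
  associator A B C := (graph V Q).mapIso (α_ A.alg B.alg C.alg)
  leftUnitor A := (graph V Q).mapIso (λ_ A.alg)
  rightUnitor A := (graph V Q).mapIso (ρ_ A.alg)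

lemma graph_tensor {A B C D : Alg E V} (f : A ⟶ B) (g : C ⟶ D) :
    (graph V Q).map f ⊗ₘ (graph V Q).map g = (graph V Q).map (f ⊗ₘ g) :=
  Quotient.sound (QSpan.tensor_graph f.hom g.hom)

/-- The monoidal structure is inherited from the finite products of algebras. -/
instance : MonoidalCategory (SpanCat V Q) := .ofTensorHom
  (id_tensorHom_id := fun A B => (graph_tensor (𝟙 A.alg) (𝟙 B.alg)).trans
    (congrArg (graph V Q).map (id_tensorHom_id A.alg B.alg)))
  (id_tensorHom := fun _ _ _ _ => rfl)
  (tensorHom_id := fun _ _ => rfl)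
  (tensorHom_comp_tensorHom := by
    rintro _ _ _ _ _ _ ⟨S⟩ ⟨S'⟩ ⟨T⟩ ⟨T'⟩
    exact Quotient.sound (QSpan.tensor_comp S.1 T.1 S'.1 T'.1))
  (associator_naturality := by
    rintro _ _ _ _ _ _ ⟨S⟩ ⟨S'⟩ ⟨S''⟩
    exact Quotient.sound (QSpan.associator_naturality S.1 S'.1 S''.1))
  (leftUnitor_naturality := by
    rintro _ _ ⟨S⟩
    exact Quotient.sound (QSpan.leftUnitor_naturality S.1))
  (rightUnitor_naturality := by
    rintro _ _ ⟨S⟩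
    exact Quotient.sound (QSpan.rightUnitor_naturality S.1))
  (pentagon := fun A B C D => by
    have h := congrArg (graph V Q).map (MonoidalCategory.pentagon A.alg B.alg C.alg D.alg)
    simp only [← MonoidalCategory.tensorHom_id, ← MonoidalCategory.id_tensorHom,
      Functor.map_comp, ← graph_tensor] at h
    exact h)
  (triangle := fun A B => by
    have h := congrArg (graph V Q).map (MonoidalCategory.triangle A.alg B.alg)
    simp only [← MonoidalCategory.tensorHom_id, ← MonoidalCategory.id_tensorHom,
      Functor.map_comp, ← graph_tensor] at h
    exact h)

lemma braiding_naturality {A B C D : SpanCat V Q} (f : A ⟶ B) (g : C ⟶ D) :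
    (f ⊗ₘ g) ≫ (graph V Q).map (β_ B.alg D.alg).hom =
      (graph V Q).map (β_ A.alg C.alg).hom ≫ (g ⊗ₘ f) := by
  obtain ⟨S⟩ := f
  obtain ⟨T⟩ := g
  have h : ∀ X Y : Alg E V, (β_ X Y).hom.hom = (β_ X.carrier Y.carrier).hom := fun X Y => by
    rw [← lift_snd_fst, ← lift_snd_fst]
    rfl
  refine Quotient.sound ?_
  change QSpan.Equiv (QSpan.comp _ (QSpan.graph _)) (QSpan.comp (QSpan.graph _) _)
  rw [h, h]
  exact QSpan.braiding_naturality S.1 T.1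

/-- The symmetry is the graph of the symmetry of the finite products of algebras. -/
instance : SymmetricCategory (SpanCat V Q) where
  braiding A B := (graph V Q).mapIso (β_ A.alg B.alg)
  braiding_naturality_right X _ _ f := braiding_naturality (𝟙 X) f
  braiding_naturality_left f Z := braiding_naturality f (𝟙 Z)
  hexagon_forward A B C := by
    have h := congrArg (graph V Q).map (BraidedCategory.hexagon_forward A.alg B.alg C.alg)
    simp only [← MonoidalCategory.tensorHom_id, ← MonoidalCategory.id_tensorHom,
      Functor.map_comp, ← graph_tensor] at h
    exact h
  hexagon_reverse A B C := by
    have h := congrArg (graph V Q).map (BraidedCategory.hexagon_reverse A.alg B.alg C.alg)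
    simp only [← MonoidalCategory.tensorHom_id, ← MonoidalCategory.id_tensorHom,
      Functor.map_comp, ← graph_tensor] at h
    exact h
  symmetry A B := by
    have h := congrArg (graph V Q).map (SymmetricCategory.symmetry A.alg B.alg)
    simp only [Functor.map_comp] at h
    exact h

end SpanCat

end SpanCat

end AlgQSpan

end

/-! The graph functor preserves tensor products and sends coherence isomorphisms to coherence
isomorphisms, so the commutative comonoids that the diagonals form in the cartesian category of
algebras become commutative comonoids of spans. The converse is a contravariant involution,
compatible with the tensor product because `⊗` on `Q` is commutative, and it turns these comonoids
into monoids.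

What links the two structures is the Beck-Chevalley identity `f_∘ ≫ (g_∘)° = (p_∘)° ≫ q_∘` for a
pullback square `p ≫ f = q ≫ g`, in which no existential quantifier is involved because only
graphs occur. The special axiom is the case of the kernel pair of the diagonal, which is a
monomorphism. The Frobenius axiom is the case of the square expressing that `Δ ▷ A` is pulled back
along the graph `⟨1, snd⟩ : A ⊗ A ⟶ (A ⊗ A) ⊗ A` of the second projection to `Δ` itself, since
`snd ∘ Δ = 1`. -/

noncomputable section

namespace AlgQSpan

open scoped ComonObj

/-- A dagger on a symmetric monoidal category: an involutive contravariant endofunctor, the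
identity on objects, that preserves the tensor product and inverts the coherence isomorphisms.
It turns comonoids into monoids; on spans it is the converse. -/
structure MonoidalDagger (C : Type u) [Category.{v} C] [MonoidalCategory C]
    [SymmetricCategory C] where
  dagger {X Y : C} : (X ⟶ Y) → (Y ⟶ X)
  dagger_id (X : C) : dagger (𝟙 X) = 𝟙 X
  dagger_comp {X Y Z : C} (f : X ⟶ Y) (g : Y ⟶ Z) : dagger (f ≫ g) = dagger g ≫ dagger f
  dagger_dagger {X Y : C} (f : X ⟶ Y) : dagger (dagger f) = f
  dagger_tensorHom {X₁ Y₁ X₂ Y₂ : C} (f : X₁ ⟶ Y₁) (g : X₂ ⟶ Y₂) :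
    dagger (f ⊗ₘ g) = dagger f ⊗ₘ dagger g
  dagger_associator_hom (X Y Z : C) : dagger (α_ X Y Z).hom = (α_ X Y Z).inv
  dagger_leftUnitor_hom (X : C) : dagger (λ_ X).hom = (λ_ X).inv
  dagger_rightUnitor_hom (X : C) : dagger (ρ_ X).hom = (ρ_ X).inv
  dagger_braiding_hom (X Y : C) : dagger (β_ X Y).hom = (β_ X Y).inv

namespace MonoidalDagger

section Symmetric

variable {C : Type u} [Category.{v} C] [MonoidalCategory C] [SymmetricCategory C]
  (D : MonoidalDagger C)

lemma dagger_whiskerLeft (X : C) {Y Z : C} (f : Y ⟶ Z) :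
    D.dagger (X ◁ f) = X ◁ D.dagger f := by
  simp only [← id_tensorHom, D.dagger_tensorHom, D.dagger_id]

lemma dagger_whiskerRight {X Y : C} (f : X ⟶ Y) (Z : C) :
    D.dagger (f ▷ Z) = D.dagger f ▷ Z := by
  simp only [← tensorHom_id, D.dagger_tensorHom, D.dagger_id]

lemma dagger_associator_inv (X Y Z : C) : D.dagger (α_ X Y Z).inv = (α_ X Y Z).hom := by
  rw [← D.dagger_associator_hom, D.dagger_dagger]

lemma dagger_leftUnitor_inv (X : C) : D.dagger (λ_ X).inv = (λ_ X).hom := by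
  rw [← D.dagger_leftUnitor_hom, D.dagger_dagger]

lemma dagger_rightUnitor_inv (X : C) : D.dagger (ρ_ X).inv = (ρ_ X).hom := by
  rw [← D.dagger_rightUnitor_hom, D.dagger_dagger]

lemma dagger_tensorμ (X₁ X₂ Y₁ Y₂ : C) :
    D.dagger (tensorμ X₁ X₂ Y₁ Y₂) = tensorμ X₁ Y₁ X₂ Y₂ := by
  simp only [tensorμ, D.dagger_comp, D.dagger_whiskerLeft, D.dagger_whiskerRight,
    D.dagger_associator_hom, D.dagger_associator_inv, D.dagger_braiding_hom, Category.assoc]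
  rw [SymmetricCategory.braiding_swap_eq_inv_braiding X₂ Y₁]

/-- The monoid obtained from a comonoid by reversing its structure morphisms along a dagger. -/
abbrev monObj (A : C) [ComonObj A] : MonObj A where
  one := D.dagger ε[A]
  mul := D.dagger Δ[A]
  one_mul := by
    rw [← D.dagger_whiskerRight, ← D.dagger_comp, ComonObj.counit_comul, D.dagger_leftUnitor_inv]
  mul_one := by
    rw [← D.dagger_whiskerLeft, ← D.dagger_comp, ComonObj.comul_counit, D.dagger_rightUnitor_inv]
  mul_assoc := by
    rw [← D.dagger_whiskerRight, ← D.dagger_whiskerLeft, ← D.dagger_associator_inv,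
      ← D.dagger_comp, ← D.dagger_comp, ← D.dagger_comp, ComonObj.comul_assoc, Category.assoc,
      Category.assoc, Iso.hom_inv_id, Category.comp_id]

lemma isCommMonObj (A : C) [ComonObj A] [IsCommComonObj A] :
    let := D.monObj A; IsCommMonObj A := by
  let := D.monObj A
  refine ⟨?_⟩
  change (β_ A A).hom ≫ D.dagger Δ[A] = D.dagger Δ[A]
  rw [SymmetricCategory.braiding_swap_eq_inv_braiding, ← D.dagger_braiding_hom, ← D.dagger_comp,
    IsCommComonObj.comul_comm]

end Symmetric

variable {C : Type u} [Category.{v} C] [MonoidalCategory C] [CopyDiscardCategory C]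

/-- The hypergraph structure whose comonoids are those of a copy-discard category and whose monoids
are their daggers. -/
def hypergraphStructure (D : MonoidalDagger C)
    (frobenius : ∀ A : C,
      A ◁ Δ[A] ≫ (α_ A A A).inv ≫ D.dagger Δ[A] ▷ A = D.dagger Δ[A] ≫ Δ[A])
    (special : ∀ A : C, Δ[A] ≫ D.dagger Δ[A] = 𝟙 A) : HypergraphStructure C where
  mon A := D.monObj A
  mon_comm A := D.isCommMonObj A
  comon A := inferInstance
  comon_comm A := inferInstance
  frobenius_left := frobenius
  -- The two halves of the Frobenius axiom are daggers of each other.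
  frobenius_right A := by
    simpa only [D.dagger_comp, D.dagger_whiskerLeft, D.dagger_whiskerRight, D.dagger_dagger,
      D.dagger_associator_inv, Category.assoc] using! congrArg D.dagger (frobenius A)
  special := special
  comul_tensor := CopyDiscardCategory.copy_tensor
  counit_tensor := CopyDiscardCategory.discard_tensor
  mul_tensor A B := by
    simpa only [D.dagger_comp, D.dagger_tensorHom, D.dagger_tensorμ] using!
      congrArg D.dagger (CopyDiscardCategory.copy_tensor A B)
  one_tensor A B := by
    simpa only [D.dagger_comp, D.dagger_tensorHom, D.dagger_leftUnitor_hom] using!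
      congrArg D.dagger (CopyDiscardCategory.discard_tensor A B)
  comul_unit := CopyDiscardCategory.copy_unit
  counit_unit := CopyDiscardCategory.discard_unit
  mul_unit := (congrArg D.dagger CopyDiscardCategory.copy_unit).trans (D.dagger_leftUnitor_inv _)
  one_unit := (congrArg D.dagger CopyDiscardCategory.discard_unit).trans (D.dagger_id _)

end MonoidalDagger

section Cartesian

variable {E : Type u} [Category.{v} E] [CartesianMonoidalCategory E]

lemma isPullback_lift_id_whiskerRight {X Y Z : E} (f : X ⟶ Y) (g : Y ⟶ Z) :
    IsPullback f (lift (𝟙 X) (f ≫ g)) (lift (𝟙 Y) g) (f ▷ Z) := by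
  refine ⟨⟨by ext <;> simp⟩, ⟨PullbackCone.IsLimit.mk _ (fun s => s.snd ≫ fst _ _) (fun s => ?_)
    (fun s => ?_) (fun s m _ h => by simp [← h])⟩⟩
  all_goals have h_base : s.fst = s.snd ≫ fst _ _ ≫ f := by simpa using s.condition =≫ fst _ _
  · simp [h_base]
  · have h_fibre : s.fst ≫ g = s.snd ≫ snd _ _ := by simpa using s.condition =≫ snd _ _
    ext
    · simp
    · simp [← h_fibre, h_base]

lemma whiskerLeft_diag_comp_associator_inv (A : E) :
    A ◁ lift (𝟙 A) (𝟙 A) ≫ (α_ A A A).inv = lift (𝟙 (A ⊗ A)) (snd A A) := by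
  ext <;> simp

lemma isPullback_diag_whiskerLeft_diag_whiskerRight (A : E) :
    IsPullback (lift (𝟙 A) (𝟙 A)) (lift (𝟙 A) (𝟙 A)) (A ◁ lift (𝟙 A) (𝟙 A) ≫ (α_ A A A).inv)
      (lift (𝟙 A) (𝟙 A) ▷ A) := by
  rw [whiskerLeft_diag_comp_associator_inv]
  simpa only [lift_snd] using isPullback_lift_id_whiskerRight (lift (𝟙 A) (𝟙 A)) (snd A A)

end Cartesian

instance Alg.mono_hom_of_isSplitMono {E : Type u} [Category.{v} E] [HasFiniteProducts E]
    {V : Variety.{w}} {A B : Alg E V} (f : A ⟶ B) [IsSplitMono f] : Mono f.hom :=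
  have : IsSplitMono f.hom :=
    .mk' ⟨(retraction f).hom, congrArg Alg.Hom.hom (IsSplitMono.id f)⟩
  inferInstance

namespace QSpan

variable {E : Type u} [Category.{v} E] [CartesianMonoidalCategory E] [HasPullbacks E]
  {Q A B C : E} [MonObj Q]

lemma converse_comp [BraidedCategory E] [IsCommMonObj Q] (S : QSpan Q A B) (T : QSpan Q B C) :
    (S.comp T).converse.Equiv (T.converse.comp S.converse) := by
  have h := IsPullback.of_hasPullback S.right T.left
  exact (comp_equiv h).converse.trans
    (Equiv.trans (equiv_mk_eq rfl rfl (mul_comm _ _)) (comp_equiv h.flip).symm)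

lemma graph_comp_converse_graph {P : E} {p : P ⟶ A} {q : P ⟶ B} {f : A ⟶ C} {g : B ⟶ C}
    (h : IsPullback p q f g) :
    ((graph (Q := Q) f).comp (graph g).converse).Equiv ((graph p).converse.comp (graph q)) := by
  refine (comp_equiv h).trans (Equiv.trans (equiv_mk_eq ?_ ?_ ?_) (comp_graph _ _ _ _).symm) <;>
    simp [MonObj.comp_one]

end QSpan

namespace SpanCat

variable {E : Type u} [Category.{v} E] [CartesianMonoidalCategory E] [BraidedCategory E]
  [HasPullbacks E] {V : Variety.{w}} {Q : PoCommMon E}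

lemma graph_whiskerLeft (A : Alg E V) {B C : Alg E V} (f : B ⟶ C) :
    (graph V Q).map (A ◁ f) = (graph V Q).obj A ◁ (graph V Q).map f :=
  (congrArg (graph V Q).map (id_tensorHom A f)).symm.trans (graph_tensor (𝟙 A) f).symm

lemma graph_whiskerRight {A B : Alg E V} (f : A ⟶ B) (C : Alg E V) :
    (graph V Q).map (f ▷ C) = (graph V Q).map f ▷ (graph V Q).obj C :=
  (congrArg (graph V Q).map (tensorHom_id f C)).symm.trans (graph_tensor f (𝟙 C)).symm

lemma graph_tensorμ (A B C D : Alg E V) :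
    (graph V Q).map (tensorμ A B C D) = tensorμ ((graph V Q).obj A) ((graph V Q).obj B)
      ((graph V Q).obj C) ((graph V Q).obj D) := by
  simp only [tensorμ, Functor.map_comp, graph_whiskerLeft, graph_whiskerRight]
  rfl

section CopyDiscard

attribute [local instance] CartesianCopyDiscard.ofCartesianMonoidalCategory

-- Each axiom is the image under `graph` of the same axiom for the diagonals of algebras.
instance (A : SpanCat V Q) : ComonObj A where
  counit := (graph V Q).map ε[A.alg]
  comul := (graph V Q).map Δ[A.alg]
  counit_comul := by
    have h := congrArg (graph V Q).map (ComonObj.counit_comul A.alg)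
    rwa [Functor.map_comp, graph_whiskerRight] at h
  comul_counit := by
    have h := congrArg (graph V Q).map (ComonObj.comul_counit A.alg)
    rwa [Functor.map_comp, graph_whiskerLeft] at h
  comul_assoc := by
    have h := congrArg (graph V Q).map (ComonObj.comul_assoc A.alg)
    rwa [Functor.map_comp, Functor.map_comp, Functor.map_comp, graph_whiskerLeft,
      graph_whiskerRight] at h

instance : CopyDiscardCategory (SpanCat V Q) where
  isCommComonObj A := ⟨((graph V Q).map_comp _ _).symm.trans
    (congrArg (graph V Q).map (IsCommComonObj.comul_comm A.alg))⟩
  copy_tensor A B := by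
    have h := congrArg (graph V Q).map (CopyDiscardCategory.copy_tensor A.alg B.alg)
    rwa [Functor.map_comp, ← graph_tensor, graph_tensorμ] at h
  discard_tensor A B := by
    have h := congrArg (graph V Q).map (CopyDiscardCategory.discard_tensor A.alg B.alg)
    rwa [Functor.map_comp, ← graph_tensor] at h
  copy_unit := congrArg (graph V Q).map CopyDiscardCategory.copy_unit
  discard_unit := congrArg (graph V Q).map CopyDiscardCategory.discard_unit

end CopyDiscard

lemma graph_comp_converse_graph {P A B C : Alg E V} {p : P ⟶ A} {q : P ⟶ B} {f : A ⟶ C}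
    {g : B ⟶ C} (h : IsPullback p.hom q.hom f.hom g.hom) :
    (graph V Q).map f ≫ converse ((graph V Q).map g) =
      converse ((graph V Q).map p) ≫ (graph V Q).map q :=
  Quotient.sound (QSpan.graph_comp_converse_graph h)

lemma graph_comp_converse_graph_self {A B : Alg E V} (f : A ⟶ B) [Mono f.hom] :
    (graph V Q).map f ≫ converse ((graph V Q).map f) = 𝟙 _ :=
  (graph_comp_converse_graph (p := 𝟙 A) (q := 𝟙 A) (IsKernelPair.id_of_mono f.hom)).trans
    (Category.comp_id (𝟙 _))

lemma converse_graph_iso {A B : Alg E V} (e : A ≅ B) :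
    converse ((graph V Q).map e.hom) = (graph V Q).map e.inv :=
  ((graph V Q).mapIso e).hom_comp_eq_id.mp (graph_comp_converse_graph_self e.hom)

variable (V Q) in
/-- The converse as a dagger on the category of algebraic `Q`-spans. -/
def converseDagger : MonoidalDagger (SpanCat V Q) where
  dagger := converse
  dagger_id _ := rfl
  dagger_comp := by
    rintro _ _ _ ⟨S⟩ ⟨T⟩
    exact Quotient.sound (QSpan.converse_comp S.1 T.1)
  dagger_dagger := by
    rintro _ _ ⟨S⟩
    rfl
  dagger_tensorHom := by
    rintro _ _ _ _ ⟨S⟩ ⟨T⟩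
    rfl
  dagger_associator_hom A B C := converse_graph_iso (α_ A.alg B.alg C.alg)
  dagger_leftUnitor_hom A := converse_graph_iso (λ_ A.alg)
  dagger_rightUnitor_hom A := converse_graph_iso (ρ_ A.alg)
  dagger_braiding_hom A B := converse_graph_iso (β_ A.alg B.alg)

lemma copy_comp_converse_copy (A : SpanCat V Q) : Δ[A] ≫ converse Δ[A] = 𝟙 A :=
  have : IsSplitMono (lift (𝟙 A.alg) (𝟙 A.alg)) := .mk' ⟨fst _ _, lift_fst _ _⟩
  graph_comp_converse_graph_self (lift (𝟙 A.alg) (𝟙 A.alg))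

lemma whiskerLeft_copy_comp_converse_copy_whiskerRight (A : SpanCat V Q) :
    A ◁ Δ[A] ≫ (α_ A A A).inv ≫ converse Δ[A] ▷ A = converse Δ[A] ≫ Δ[A] := by
  let diag := lift (𝟙 A.alg) (𝟙 A.alg)
  have h_whiskerRight : converse ((graph V Q).map (diag ▷ A.alg)) = converse Δ[A] ▷ A := by
    rw [graph_whiskerRight]
    exact (converseDagger V Q).dagger_whiskerRight Δ[A] A
  have h := graph_comp_converse_graph (Q := Q) (p := diag) (q := diag)
    (f := A.alg ◁ diag ≫ (α_ _ _ _).inv) (g := diag ▷ A.alg)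
    (isPullback_diag_whiskerLeft_diag_whiskerRight A.alg.carrier)
  rw [Functor.map_comp, graph_whiskerLeft, h_whiskerRight] at h
  exact (Category.assoc _ _ _).symm.trans h

variable (V Q) in
/-- The hypergraph structure given by the diagonals of algebras and their converses. -/
def hypergraphStructure : HypergraphStructure (SpanCat V Q) :=
  (converseDagger V Q).hypergraphStructure whiskerLeft_copy_comp_converse_copy_whiskerRight
    copy_comp_converse_copy

end SpanCat

end AlgQSpan

end

theorem mainTheorem2_general {E : Type u} [Category.{v} E] [CartesianMonoidalCategory E]
    [BraidedCategory E] [HasPullbacks E] (V : AlgQSpan.Variety.{w}) (Q : AlgQSpan.PoCommMon E) :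
    ∃ H : AlgQSpan.HypergraphStructure (AlgQSpan.SpanCat V Q), ∀ A : AlgQSpan.Alg E V,
      (H.comon ⟨A⟩).counit = (AlgQSpan.SpanCat.graph V Q).map (toUnit A) ∧
      (H.comon ⟨A⟩).comul = (AlgQSpan.SpanCat.graph V Q).map (lift (𝟙 A) (𝟙 A)) ∧
      (H.mon ⟨A⟩).one =
        AlgQSpan.SpanCat.converse ((AlgQSpan.SpanCat.graph V Q).map (toUnit A)) ∧
      (H.mon ⟨A⟩).mul =
        AlgQSpan.SpanCat.converse ((AlgQSpan.SpanCat.graph V Q).map (lift (𝟙 A) (𝟙 A))) :=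
  ⟨AlgQSpan.SpanCat.hypergraphStructure V Q, fun _ => ⟨rfl, rfl, rfl, rfl⟩⟩

theorem mainTheorem2 {E : Type u} [Category.{v} E] [CartesianMonoidalCategory E]
    [BraidedCategory E] [HasFiniteLimits E] [MonoidalClosed E] [HasSubobjectClassifier E]
    (V : AlgQSpan.Variety.{w}) (Q : AlgQSpan.PoCommMon E) :
    ∃ H : AlgQSpan.HypergraphStructure (AlgQSpan.SpanCat V Q), ∀ A : AlgQSpan.Alg E V,
      (H.comon ⟨A⟩).counit = (AlgQSpan.SpanCat.graph V Q).map (toUnit A) ∧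
      (H.comon ⟨A⟩).comul = (AlgQSpan.SpanCat.graph V Q).map (lift (𝟙 A) (𝟙 A)) ∧
      (H.mon ⟨A⟩).one =
        AlgQSpan.SpanCat.converse ((AlgQSpan.SpanCat.graph V Q).map (toUnit A)) ∧
      (H.mon ⟨A⟩).mul =
        AlgQSpan.SpanCat.converse ((AlgQSpan.SpanCat.graph V Q).map (lift (𝟙 A) (𝟙 A))) :=
  mainTheorem2_general V Q
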